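/- \textbf{Setting.} Let $I$ (agents) and $N$ (items) be finite sets. The type of agent $i$ is $\tau=(v,h)$, where the vertical type $v$ lies in a finite set $V_i\subset\mathbb{R}_+$ and the horizontal type $h:N\to\mathbb{R}$ is a permutation of fixed levels $h^1>\dots>h^{|N|}$. Types are independent across agents, $\mu_i$ is the distribution of $i$'s type, and every $v\in V_i$ has positive probability. An agent of type $(v,h)$ who gets item $n$ with probability $q(n)$ and pays $p$ has payoff $v\sum_n q(n)h(n)-p$. An allocation is a map $q(t,i,n)\ge 0$ with $\sum_n q(t,i,n)\le 1$ and $\sum_i q(t,i,n)\le 1$ for every type profile $t$; it induces the interim allocation $Q(i,\tau,n)=E[q((\tau,t_{-i}),i,n)]$, and interim allocations of this form are called realizable. With $F_i(\cdot|h)$, $f_i(\cdot|h)$ the distribution and mass function of $v$ given $h$, let $\nu_i(v|h)=v-\frac{1-F_i(v|h)}{f_i(v|h)}$ and $$Rev(Q)=\sum_{i,(v,h),n}\nu_i(v|h)\,h(n)\,\mu_i(v,h)\,Q(i,(v,h),n).$$ Let $R$ be a strict order of all triples $(i,(v,h),n)$ that is decreasing in $\nu_i(v|h)h(n)$, ties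 between different agents being broken by a fixed priority order of the agents. The $R$-greedy allocation processes, for each type profile $t$, the triples in the order $R$ and gives $n$ to $i$ when $(i,\tau,n)$ with $\tau=t_i$ is reached and neither $i$ nor $n$ is matched yet. The truncated $R$-greedy allocation does the same with the triples for which $\nu_i(v|h)h(n)>0$ only. For interim allocations, $Q'$ is an $R$-FOSD improvement of $Q$ if $\sum_{l\le k}Q(i_l,\tau_l,n_l)\mu_{i_l}(\tau_l)\le\sum_{l\le k}Q'(i_l,\tau_l,n_l)\mu_{i_l}(\tau_l)$ for all $k$, the triples being indexed in the order $R$. \textbf{Proposition.} Assume that for every agent (i) $v$ and $h$ are independent, (ii) horizontal types are the permutations of $\{1,\dots,|N|\}$ and are uniformly distributed, and (iii) $v\mapsto\nu_i(v)$ is weakly increasing. Both components of the type are private information. Then: (a) The truncated $R$-greedy allocation is a feasible allocation, its interim allocation $\hat Q$ satisfies $Rev(\hat Q)\ge\frac12 Rev(Q)$ for every realizable $Q$, and there are payments that make it Bayesian incentive compatible and interim individually rational. (b) The $R$-greedy allocation is a feasible allocation with interim allocation $Q^R$. If the principal's objective $V(Q)=U(Q)+\beta Rev(Q)$ is concave on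 the set of realizable interim allocations, is zero at the null allocation, and is monotone with respect to $R$-FOSD improvements between realizable interim allocations, then $V(Q^R)\ge\frac12 V(Q)$ for every realizable $Q$. If all virtual values are nonnegative and $R$ breaks ties between items for the same agent and type in favour of the preferred item, then also $Rev(Q^R)\ge\frac12Rev(Q)$ for every realizable $Q$, and there are payments that make the $R$-greedy allocation Bayesian incentive compatible and interim individually rational. In (a) and (b) the payments can be chosen such that, if in addition each $V_i$ consists of consecutive points at distance $1$, the expected total payment equals $Rev(\hat Q)$, respectively $Rev(Q^R)$. -/

import Mathlib

open Finset

noncomputable section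

namespace Matching

/-- A matching environment with finite sets `I` of agents and `N` of items. A type of agent `i` is
a pair (vertical type, horizontal type). The vertical type is an element of the finite set
`V i` of nonnegative reals. The horizontal type assigns the values
`level 0 < level 1 < ...` to the items, one level to each item; it is recorded as the bijection
from items to levels, so that a larger index is a better item. `μ i` is the
distribution of the type of agent `i`; types are independent across agents. -/
structure Env (I N : Type) [Fintype N] [DecidableEq N] where
  V : I → Finset ℝ
  V_nonneg : ∀ i, ∀ v ∈ V i, 0 ≤ v
  level : Fin (Fintype.card N) → ℝ
  level_strictMono : StrictMono level
  μ : (i : I) → ↥(V i) × (N ≃ Fin (Fintype.card N)) → ℝ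
  μ_nonneg : ∀ i τ, 0 ≤ μ i τ
  μ_sum : ∀ i, ∑ τ, μ i τ = 1

namespace Env

variable {I N : Type} [Fintype I] [DecidableEq I] [Fintype N] [DecidableEq N]

/-- Types of agent `i`. -/
abbrev Ty (E : Env I N) (i : I) : Type := ↥(E.V i) × (N ≃ Fin (Fintype.card N))

/-- Type profiles (states). -/
abbrev State (E : Env I N) : Type := (i : I) → E.Ty i

/-- Triples (agent, type of that agent, item). -/
abbrev Triple (E : Env I N) : Type := Σ i : I, E.Ty i × N

/-- The value `h(n)` that the horizontal type `h` gives to item `n`. -/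
def hval (E : Env I N) (h : N ≃ Fin (Fintype.card N)) (n : N) : ℝ := E.level (h n)

/-- Probability of a state; types are independent across agents. -/
def prob (E : Env I N) (t : E.State) : ℝ := ∏ i, E.μ i (t i)

/-- Probability of the vertical type `v` of agent `i`. -/
def vMarg (E : Env I N) (i : I) (v : ↥(E.V i)) : ℝ := ∑ h, E.μ i (v, h)

/-- Probability of the horizontal type `h` of agent `i`. -/
def hMarg (E : Env I N) (i : I) (h : N ≃ Fin (Fintype.card N)) : ℝ := ∑ v, E.μ i (v, h)

/-- Mass function `f_i(v|h)` of the vertical type conditional on the horizontal type. -/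
def condMass (E : Env I N) (i : I) (v : ↥(E.V i)) (h : N ≃ Fin (Fintype.card N)) : ℝ :=
  E.μ i (v, h) / E.hMarg i h

/-- Distribution function `F_i(v|h)` of the vertical type conditional on the horizontal type. -/
def condCDF (E : Env I N) (i : I) (v : ↥(E.V i)) (h : N ≃ Fin (Fintype.card N)) : ℝ :=
  ∑ w ∈ univ.filter (fun w : ↥(E.V i) => w ≤ v), E.condMass i w h

/-- Virtual value `ν_i(v|h) = v - (1 - F_i(v|h)) / f_i(v|h)`. -/
def virtualValue (E : Env I N) (i : I) (v : ↥(E.V i)) (h : N ≃ Fin (Fintype.card N)) : ℝ :=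
  (v : ℝ) - (1 - E.condCDF i v h) / E.condMass i v h

/-- The weight `ν_i(v|h) h(n)` of the triple `(i, (v, h), n)`. -/
def weight (E : Env I N) (a : E.Triple) : ℝ :=
  E.virtualValue a.1 a.2.1.1 a.2.1.2 * E.hval a.2.1.2 a.2.2

/-- Allocations: `q t i n` is the probability that `i` gets item `n` in state `t`, with unit demand
of agents and unit supply of items. -/
def IsAllocation (E : Env I N) (q : E.State → I → N → ℝ) : Prop :=
  ∀ t, (∀ i n, 0 ≤ q t i n) ∧ (∀ i, ∑ n, q t i n ≤ 1) ∧ (∀ n, ∑ i, q t i n ≤ 1)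

/-- The interim allocation induced by `q`: the probability that `i` gets `n` given the type `τ`. Since
types are independent across agents, it is obtained by drawing a state and then
replacing the type of `i` by `τ`. -/
def interim (E : Env I N) (q : E.State → I → N → ℝ) (a : E.Triple) : ℝ :=
  ∑ t : E.State, E.prob t * q (Function.update t a.1 a.2.1) a.1 a.2.2

/-- Realizable interim allocations. -/
def realizable (E : Env I N) : Set (E.Triple → ℝ) :=
  {Q | ∃ q, E.IsAllocation q ∧ Q = E.interim q}

/-- `Rev(Q)`: the sum of `ν_i(v|h) h(n) μ_i(v,h) Q(i,(v,h),n)` over all triples. -/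
def rev (E : Env I N) (Q : E.Triple → ℝ) : ℝ :=
  ∑ a : E.Triple, E.weight a * E.μ a.1 a.2.1 * Q a

/-- An enumeration of all triples, which represents the strict order in which
triples with a smaller index come first (are higher). -/
abbrev Order (E : Env I N) : Type := Fin (Fintype.card E.Triple) ≃ E.Triple

open Classical in
/-- The assignments made in state `t` after the first `k` triples have been processed: a triple
`(i, τ, n)` is skipped unless it belongs to `A`, `i` has type `τ`, and `i` and `n` are both still
unmatched. -/
def greedyStep (E : Env I N) (R : E.Order) (A : Set E.Triple) (t : E.State) : ℕ → Finset (I × N)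
  | 0 => ∅
  | k + 1 =>
    if hk : k < Fintype.card E.Triple then
      let a := R ⟨k, hk⟩
      if a ∈ A ∧ t a.1 = a.2.1 ∧ ∀ p ∈ greedyStep E R A t k, p.1 ≠ a.1 ∧ p.2 ≠ a.2.2 then
        insert (a.1, a.2.2) (greedyStep E R A t k)
      else greedyStep E R A t k
    else greedyStep E R A t k

/-- The greedy matching allocation for the order `R`, restricted to the triples in `A`. -/
def greedy (E : Env I N) (R : E.Order) (A : Set E.Triple) (t : E.State) (i : I) (n : N) : ℝ :=
  if (i, n) ∈ E.greedyStep R A t (Fintype.card E.Triple) then 1 else 0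

/-- `R` lists the triples in decreasing order of `ν_i(v|h) h(n)`, ties between different
agents being broken by the base priority `base` (a smaller number is a higher priority). -/
def IsDesignOrder (E : Env I N) (base : I ≃ Fin (Fintype.card I)) (R : E.Order) : Prop :=
  (∀ k l, k < l → E.weight (R l) ≤ E.weight (R k)) ∧
  ∀ a b : E.Triple, E.weight a = E.weight b → base a.1 < base b.1 → R.symm a < R.symm b

/-- Ties between different items for the same agent and type are broken in favour of the
item that the type prefers. -/
def BreaksItemTiesByPreference (E : Env I N) (R : E.Order) : Prop :=
  ∀ (i : I) (τ : E.Ty i) (n m : N), E.weight ⟨i, τ, n⟩ = E.weight ⟨i, τ, m⟩ →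
    E.hval τ.2 m < E.hval τ.2 n → R.symm ⟨i, τ, n⟩ < R.symm ⟨i, τ, m⟩

/-- `Q` is first-order dominated by `Q'` for the order `R`. -/
def FOSDDominated (E : Env I N) (R : E.Order) (Q Q' : E.Triple → ℝ) : Prop :=
  ∀ k, ∑ l ∈ Finset.Iic k, Q (R l) * E.μ (R l).1 (R l).2.1
    ≤ ∑ l ∈ Finset.Iic k, Q' (R l) * E.μ (R l).1 (R l).2.1

/-- Objectives of the principal: concave, zero at the null allocation, and monotone with respect to
first-order shifts for the order `R`. -/
def IsObjective (E : Env I N) (R : E.Order) (W : (E.Triple → ℝ) → ℝ) : Prop :=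
  ConcaveOn ℝ E.realizable W ∧ W 0 = 0 ∧
  ∀ Q ∈ E.realizable, ∀ Q' ∈ E.realizable, E.FOSDDominated R Q Q' → W Q ≤ W Q'

/-- Expected payoff of agent `i` with true type `τ` from reporting `τ'` when the other agents report
truthfully, in the direct mechanism with allocation `q` and payments `p`. -/
def interimPayoff (E : Env I N) (q : E.State → I → N → ℝ) (p : E.State → I → ℝ)
    (i : I) (τ τ' : E.Ty i) : ℝ :=
  ∑ t : E.State, E.prob t *
    ((τ.1 : ℝ) * ∑ n, q (Function.update t i τ') i n * E.hval τ.2 n - p (Function.update t i τ') i)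

/-- Bayesian incentive compatibility when vertical and horizontal types are both private. -/
def BIC (E : Env I N) (q : E.State → I → N → ℝ) (p : E.State → I → ℝ) : Prop :=
  ∀ (i : I) (τ τ' : E.Ty i), E.interimPayoff q p i τ τ' ≤ E.interimPayoff q p i τ τ

/-- Interim individual rationality. -/
def IIR (E : Env I N) (q : E.State → I → N → ℝ) (p : E.State → I → ℝ) : Prop :=
  ∀ (i : I) (τ : E.Ty i), 0 ≤ E.interimPayoff q p i τ τ

/-- Expected total payment under truthful reports. -/
def expectedPayment (E : Env I N) (p : E.State → I → ℝ) : ℝ :=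
  ∑ t : E.State, E.prob t * ∑ i, p t i

/-- Every vertical type set consists of consecutive points at distance one, the grid for which the
virtual value `v - (1 - F) / f` is the exact one. -/
def UnitGrid (E : Env I N) : Prop :=
  ∀ i, ∃ (c : ℝ) (k : ℕ), E.V i = (Finset.range k).image (fun j : ℕ => c + (j : ℝ))

/-- There are payments that make `q` Bayesian incentive compatible and individually
rational; on a unit grid they raise exactly `Rev` of the induced interim allocation. -/
def ImplementableBIC (E : Env I N) (q : E.State → I → N → ℝ) : Prop :=
  ∃ p : E.State → I → ℝ, E.BIC q p ∧ E.IIR q p ∧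
    (E.UnitGrid → E.expectedPayment p = E.rev (E.interim q))

/-- The vertical and the horizontal type of every agent are independent. -/
def VHIndependent (E : Env I N) : Prop :=
  ∀ i v h, E.μ i (v, h) = E.vMarg i v * E.hMarg i h

/-- Horizontal types are uniform: every horizontal type is a permutation of `1, ..., |N|`. -/
def UniformLevels (E : Env I N) : Prop :=
  ∀ r : Fin (Fintype.card N), E.level r = (r : ℝ) + 1

/-- The horizontal type of every agent is uniformly distributed. -/
def UniformlyDistributed (E : Env I N) : Prop :=
  ∀ i h, E.hMarg i h = 1 / ((Fintype.card N).factorial : ℝ)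

end Env

end Matching

end

/-! The bound of one half is a charging argument. An admissible pair that the greedy matching passes
over shares its agent or its item with a matched pair that comes earlier, hence is worth at least as
much. So the greedy values of the agents and of the items form a feasible dual solution of the
assignment problem, whose cost is twice the greedy value. This works state by state for any value
that decreases along `R`, is nonnegative on the admissible triples and nonpositive elsewhere
(`sum_le_two_mul_sum_greedy`). The weights give the revenue bound. Indicators of initial segments of
`R` show that the greedy allocation dominates `Q / 2`, and concavity yields the bound for general
objectives.

For incentives, independence and uniformity make the environment symmetric under relabelling of
items, and the greedy matching commutes with relabelling (`matched_relabelState`). Hence the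
expected quality depends on the vertical type only, and a horizontal misreport merely permutes
interim probabilities. Better items are obtained with higher probability, so truth is optimal by the
rearrangement inequality (`misreport_le_quality`). Raising the weight of the triple that serves an
agent cannot worsen the match (`exists_matched_update`), so quality increases with the vertical type
and envelope payments implement it. On a unit grid, exchanging sums turns expected rents into
inverse hazard rates. -/

noncomputable section

set_option linter.unusedSectionVars false

namespace Matching

/-! ### Information rents for one-dimensional types -/

/-- Discrete envelope formula: a weakly increasing quality on a finite set of values can be
supported by nonnegative information rents. -/
theorem exists_rent (V : Finset ℝ) (x : ℝ → ℝ) (hx : MonotoneOn x V) (hx0 : ∀ v ∈ V, 0 ≤ x v) :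
    ∃ S : ℝ → ℝ, (∀ v ∈ V, 0 ≤ S v) ∧ ∀ v ∈ V, ∀ w ∈ V, S w + (v - w) * x w ≤ S v := by
  induction V using Finset.induction_on_max with
  | empty => exact ⟨0, by simp⟩
  | insert b s hb ih =>
    obtain ⟨S, hS0, hS⟩ := ih (hx.mono (by simp)) fun v hv => hx0 v (mem_insert_of_mem hv)
    -- `M` is the rent of the new largest value `b`, namely its best payoff from imitating a smaller
    -- value. If `u` attains it, a value `w` that imitates `b` gains no more than by imitating `u`,
    -- because `x u ≤ x b` and `w < b`.
    obtain ⟨M, hM0, hM1, hM2⟩ : ∃ M : ℝ, 0 ≤ M ∧ (∀ w ∈ s, S w + (b - w) * x w ≤ M) ∧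
        ∀ w ∈ s, M + (w - b) * x b ≤ S w := by
      rcases s.eq_empty_or_nonempty with rfl | hne
      · exact ⟨0, le_rfl, by simp, by simp⟩
      · obtain ⟨u, hu, hmax⟩ := s.exists_max_image (fun w => S w + (b - w) * x w) hne
        refine ⟨S u + (b - u) * x u, ?_, hmax, fun w hw => ?_⟩
        · have := mul_nonneg (sub_nonneg.2 (hb u hu).le) (hx0 u (mem_insert_of_mem hu))
          linarith [hS0 u hu]
        · have h1 := hS w hw u hu
          have h2 : x u ≤ x b := hx (by simp [hu]) (by simp) (hb u hu).le
          have h3 := mul_le_mul_of_nonneg_left h2 (sub_nonneg.2 (hb w hw).le)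
          linarith
    have hbs : ∀ w ∈ s, w ≠ b := fun w hw => (hb w hw).ne
    refine ⟨Function.update S b M, fun v hv => ?_, fun v hv w hw => ?_⟩
    · rcases mem_insert.1 hv with rfl | hv
      · simpa using hM0
      · rw [Function.update_of_ne (hbs v hv)]
        exact hS0 v hv
    · rw [mem_insert] at hv hw
      rcases hv with rfl | hv <;> rcases hw with rfl | hw
      · simp
      · rw [Function.update_self, Function.update_of_ne (hbs w hw)]
        exact hM1 w hw
      · rw [Function.update_self, Function.update_of_ne (hbs v hv)]
        exact hM2 v hv
      · rw [Function.update_of_ne (hbs v hv), Function.update_of_ne (hbs w hw)]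
        exact hS v hv w hw

/-- The two partial sums differ by the terms between `j` and `l`, each of which is at least `y l` if
`l ≤ j` and at most `y l` if `j ≤ l`. This is incentive compatibility of the grid rents. -/
theorem sum_range_add_le {y : ℕ → ℝ} {k : ℕ} (hy : ∀ j < k, ∀ l < k, j ≤ l → y j ≤ y l) {j l : ℕ}
    (hj : j < k) (hl : l < k) :
    ∑ m ∈ range l, y m + ((j : ℝ) - l) * y l ≤ ∑ m ∈ range j, y m := by
  rcases le_total l j with h | h
  · rw [← sum_range_add_sum_Ico _ h]
    have := card_nsmul_le_sum (Ico l j) y (y l) fun m hm => by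
      rw [mem_Ico] at hm; exact hy l hl m (hm.2.trans hj) hm.1
    rw [Nat.card_Ico, nsmul_eq_mul, Nat.cast_sub h] at this
    linarith
  · rw [← sum_range_add_sum_Ico _ h]
    have := sum_le_card_nsmul (Ico j l) y (y l) fun m hm => by
      rw [mem_Ico] at hm; exact hy m (hm.2.trans hl) l hl hm.2.le
    rw [Nat.card_Ico, nsmul_eq_mul, Nat.cast_sub h] at this
    linarith

/-- On a unit grid the information rents can be taken to be the sums of the qualities of all
smaller values. -/
theorem exists_rent_grid (V : Finset ℝ) (x : ℝ → ℝ) (hx : MonotoneOn x V)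
    (hx0 : ∀ v ∈ V, 0 ≤ x v) :
    ∃ S : ℝ → ℝ, (∀ v ∈ V, 0 ≤ S v) ∧ (∀ v ∈ V, ∀ w ∈ V, S w + (v - w) * x w ≤ S v) ∧
      ((∃ (c : ℝ) (k : ℕ), V = (range k).image (fun j : ℕ => c + (j : ℝ))) →
        ∀ v ∈ V, S v = ∑ w ∈ V with w < v, x w) := by
  by_cases hgrid : ∃ (c : ℝ) (k : ℕ), V = (range k).image (fun j : ℕ => c + (j : ℝ))
  · refine ⟨fun v => ∑ w ∈ V with w < v, x w,
      fun v _ => sum_nonneg fun w hw => hx0 w (mem_filter.1 hw).1, ?_, fun _ _ _ => rfl⟩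
    obtain ⟨c, k, hV⟩ := hgrid
    have hsum : ∀ j < k, ∑ w ∈ V with w < c + (j : ℝ), x w = ∑ m ∈ range j, x (c + (m : ℝ)) := by
      intro j hj
      rw [← sum_image (f := x) (g := fun m : ℕ => c + (m : ℝ)) fun a _ b _ h => by simpa using h]
      refine sum_congr ?_ fun _ _ => rfl
      ext w
      simp only [hV, mem_filter, mem_image, mem_range]
      constructor
      · rintro ⟨⟨m, -, rfl⟩, hlt⟩
        exact ⟨m, by simpa using hlt, rfl⟩
      · rintro ⟨m, hm, rfl⟩
        exact ⟨⟨m, hm.trans hj, rfl⟩, by simpa using hm⟩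
    have hmem : ∀ j < k, c + (j : ℝ) ∈ (V : Set ℝ) := fun j hj => by
      rw [mem_coe, hV]; exact mem_image_of_mem _ (mem_range.2 hj)
    have hmono : ∀ j < k, ∀ l < k, j ≤ l → x (c + (j : ℝ)) ≤ x (c + (l : ℝ)) :=
      fun j hj l hl hjl => hx (hmem j hj) (hmem l hl) (by simpa using hjl)
    intro v hv w hw
    rw [hV, mem_image] at hv hw
    obtain ⟨j, hj, rfl⟩ := hv
    obtain ⟨l, hl, rfl⟩ := hw
    rw [mem_range] at hj hl
    dsimp only
    rw [hsum j hj, hsum l hl, add_sub_add_left_eq_sub]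
    exact sum_range_add_le (y := fun m => x (c + (m : ℝ))) hmono hj hl
  · obtain ⟨S, h0, h1⟩ := exists_rent V x hx hx0
    exact ⟨S, h0, h1, fun h => absurd h hgrid⟩

namespace Env

variable {I N : Type} [Fintype I] [DecidableEq I] [Fintype N] [DecidableEq N]

/-! ### The greedy matching without the algorithm -/

/-- The position in the order `R` of the triple that the pair `p` forms in state `t`. -/
def pos (E : Env I N) (R : E.Order) (t : E.State) (p : I × N) : Fin (Fintype.card E.Triple) :=
  R.symm ⟨p.1, t p.1, p.2⟩

/-- The matching that the greedy algorithm produces in state `t`. -/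
def matched (E : Env I N) (R : E.Order) (A : Set E.Triple) (t : E.State) : Finset (I × N) :=
  E.greedyStep R A t (Fintype.card E.Triple)

theorem pos_injective (E : Env I N) (R : E.Order) (t : E.State) :
    Function.Injective (E.pos R t) := by
  rintro ⟨i, n⟩ ⟨j, m⟩ h
  have h' := R.symm.injective h
  simp only [Sigma.mk.injEq] at h'
  obtain ⟨rfl, h'⟩ := h'
  have := (Prod.mk.inj (eq_of_heq h')).2
  exact Prod.ext rfl this

/-- A pair can enter only when its own triple is processed, so its fate is settled by the matching
just before that step. -/
theorem mem_greedyStep (E : Env I N) (R : E.Order) (A : Set E.Triple) (t : E.State)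
    (k : ℕ) (p : I × N) :
    p ∈ E.greedyStep R A t k ↔ (E.pos R t p : ℕ) < k ∧ (⟨p.1, t p.1, p.2⟩ : E.Triple) ∈ A ∧
      ∀ p' ∈ E.greedyStep R A t (E.pos R t p), p'.1 ≠ p.1 ∧ p'.2 ≠ p.2 := by
  induction k with
  | zero => simp [greedyStep]
  | succ k ih =>
    by_cases hk : k < Fintype.card E.Triple
    · by_cases hp : (E.pos R t p : ℕ) = k
      · have hR : R ⟨k, hk⟩ = ⟨p.1, t p.1, p.2⟩ := by
          rw [← Equiv.eq_symm_apply]; exact Fin.ext hp.symm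
        have hnot : p ∉ E.greedyStep R A t k := fun h => by
          have := (ih.1 h).1; omega
        rw [greedyStep, dif_pos hk, hp]
        dsimp only
        -- The type component depends on the agent, so the triple is made a variable before
        -- substituting.
        generalize R ⟨k, hk⟩ = a at hR
        subst hR
        split_ifs with hc
        · rw [mem_insert, eq_self_iff_true, true_or, true_iff]
          exact ⟨Nat.lt_succ_self k, hc.1, hc.2.2⟩
        · simp only [hnot, false_iff]
          rintro ⟨-, h1, h2⟩
          exact hc ⟨h1, rfl, h2⟩
      · have hlt : (E.pos R t p : ℕ) < k + 1 ↔ (E.pos R t p : ℕ) < k := by omega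
        rw [hlt, ← ih, greedyStep, dif_pos hk]
        dsimp only
        split_ifs with hc
        · rw [mem_insert, or_iff_right]
          intro h
          apply hp
          have : (⟨p.1, t p.1, p.2⟩ : E.Triple) = R ⟨k, hk⟩ := by
            rw [h]; dsimp only; rw [hc.2.1]
          simp only [pos, this, Equiv.symm_apply_apply]
        · rfl
    · have hlt : (E.pos R t p : ℕ) < k + 1 ↔ (E.pos R t p : ℕ) < k := by
        have := (E.pos R t p).2; omega
      rw [hlt, ← ih, greedyStep, dif_neg hk]

theorem mem_greedyStep_iff_matched (E : Env I N) (R : E.Order) (A : Set E.Triple) (t : E.State)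
    (k : ℕ) (p : I × N) :
    p ∈ E.greedyStep R A t k ↔ p ∈ E.matched R A t ∧ (E.pos R t p : ℕ) < k := by
  rw [matched, mem_greedyStep, mem_greedyStep E R A t (Fintype.card E.Triple)]
  have := (E.pos R t p).2
  tauto

/-- This fixed-point description determines the matching by induction on positions and replaces the
recursion in all later arguments. -/
theorem mem_matched (E : Env I N) (R : E.Order) (A : Set E.Triple) (t : E.State) (p : I × N) :
    p ∈ E.matched R A t ↔ (⟨p.1, t p.1, p.2⟩ : E.Triple) ∈ A ∧
      ∀ p' ∈ E.matched R A t, E.pos R t p' < E.pos R t p → p'.1 ≠ p.1 ∧ p'.2 ≠ p.2 := by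
  conv_lhs => rw [matched, mem_greedyStep]
  simp only [(E.pos R t p).2, true_and, mem_greedyStep_iff_matched, and_imp, Fin.lt_def]

theorem matched_unique (E : Env I N) (R : E.Order) (A : Set E.Triple) (t : E.State) {p p' : I × N}
    (hp : p ∈ E.matched R A t) (hp' : p' ∈ E.matched R A t) (h : p.1 = p'.1 ∨ p.2 = p'.2) :
    p = p' := by
  have h1 := ((E.mem_matched R A t p).1 hp).2 p' hp'
  have h2 := ((E.mem_matched R A t p').1 hp').2 p hp
  rcases lt_trichotomy (E.pos R t p) (E.pos R t p') with hlt | heq | hlt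
  · have := h2 hlt; tauto
  · exact E.pos_injective R t heq
  · have := h1 hlt
    rcases h with h | h
    · exact absurd h.symm this.1
    · exact absurd h.symm this.2

theorem greedy_eq (E : Env I N) (R : E.Order) (A : Set E.Triple) (t : E.State) (i : I) (n : N) :
    E.greedy R A t i n = if (i, n) ∈ E.matched R A t then 1 else 0 := rfl

theorem greedy_nonneg (E : Env I N) (R : E.Order) (A : Set E.Triple) (t : E.State) (i : I)
    (n : N) : 0 ≤ E.greedy R A t i n := by
  rw [greedy_eq]; split_ifs <;> norm_num

theorem greedy_isAllocation (E : Env I N) (R : E.Order) (A : Set E.Triple) :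
    E.IsAllocation (E.greedy R A) := by
  refine fun t => ⟨E.greedy_nonneg R A t, fun i => ?_, fun n => ?_⟩
  · simp only [greedy_eq, sum_boole]
    norm_cast
    rw [card_le_one]
    intro a ha b hb
    rw [mem_filter] at ha hb
    exact (Prod.mk.inj (E.matched_unique R A t ha.2 hb.2 (Or.inl rfl))).2
  · simp only [greedy_eq, sum_boole]
    norm_cast
    rw [card_le_one]
    intro a ha b hb
    rw [mem_filter] at ha hb
    exact (Prod.mk.inj (E.matched_unique R A t ha.2 hb.2 (Or.inr rfl))).1

/-! ### The factor one half -/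

/-- In each state the greedy matching gets at least half of the value of any allocation, for every
nonnegative value of the triples that decreases along `R` and vanishes outside `A`. -/
theorem sum_le_two_mul_sum_greedy (E : Env I N) (R : E.Order) (A : Set E.Triple)
    (g : E.Triple → ℝ) (hg0 : ∀ a ∈ A, 0 ≤ g a) (hgA : ∀ a, a ∉ A → g a ≤ 0)
    (hg : ∀ k l, k ≤ l → g (R l) ≤ g (R k)) {q : E.State → I → N → ℝ} (hq : E.IsAllocation q)
    (t : E.State) :
    ∑ i, ∑ n, g ⟨i, t i, n⟩ * q t i n ≤ 2 * ∑ i, ∑ n, g ⟨i, t i, n⟩ * E.greedy R A t i n := by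
  set x := E.greedy R A t with hx
  set w : I → N → ℝ := fun i n => g ⟨i, t i, n⟩ with hw
  have hwx : ∀ i n, 0 ≤ w i n * x i n := fun i n => by
    rw [hx, greedy_eq]
    split_ifs with h
    · simpa using hg0 _ ((E.mem_matched R A t _).1 h).1
    · simp
  -- Dual feasibility: the greedy value in row `i` plus that in column `n` covers the pair. It is
  -- charged to itself if matched, otherwise to the earlier pair that blocks it.
  have hcharge : ∀ i n, w i n ≤ ∑ m, w i m * x i m + ∑ j, w j n * x j n := by
    intro i n
    have hR0 : 0 ≤ ∑ m, w i m * x i m := sum_nonneg fun m _ => hwx i m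
    have hC0 : 0 ≤ ∑ j, w j n * x j n := sum_nonneg fun j _ => hwx j n
    by_cases hA : (⟨i, t i, n⟩ : E.Triple) ∈ A
    swap
    · exact (hgA _ hA).trans (by positivity)
    have key : ∃ p ∈ E.matched R A t, E.pos R t p ≤ E.pos R t (i, n) ∧ (p.1 = i ∨ p.2 = n) := by
      by_cases hm : (i, n) ∈ E.matched R A t
      · exact ⟨_, hm, le_rfl, Or.inl rfl⟩
      · by_contra! hno
        apply hm
        rw [mem_matched]
        exact ⟨hA, fun p hp hlt => hno p hp hlt.le⟩
    obtain ⟨⟨j, m⟩, hp, hle, hor⟩ := key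
    have hwle : w i n ≤ w j m * x j m := by
      have := hg _ _ hle
      simp only [pos, Equiv.apply_symm_apply] at this
      simpa [hx, greedy_eq, hp] using this
    rcases hor with h | h
    · dsimp only at h
      subst h
      have := single_le_sum (fun m _ => hwx j m) (mem_univ m)
      linarith
    · dsimp only at h
      subst h
      have := single_le_sum (fun j _ => hwx j m) (mem_univ j)
      linarith
  obtain ⟨hq0, hq1, hq2⟩ := hq t
  -- Weak duality: rows and columns of `q` sum to at most one, so each greedy value is counted at
  -- most twice.
  calc ∑ i, ∑ n, w i n * q t i n
      ≤ ∑ i, ∑ n, (∑ m, w i m * x i m + ∑ j, w j n * x j n) * q t i n :=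
        sum_le_sum fun i _ => sum_le_sum fun n _ =>
          mul_le_mul_of_nonneg_right (hcharge i n) (hq0 i n)
    _ = ∑ i, (∑ m, w i m * x i m) * ∑ n, q t i n + ∑ n, (∑ j, w j n * x j n) * ∑ i, q t i n := by
        simp only [add_mul, sum_add_distrib, mul_sum]
        congr 1
        exact sum_comm
    _ ≤ ∑ i, (∑ m, w i m * x i m) + ∑ n, (∑ j, w j n * x j n) := by
        refine add_le_add (sum_le_sum fun i _ => ?_) (sum_le_sum fun n _ => ?_)
        · exact mul_le_of_le_one_right (sum_nonneg fun m _ => hwx i m) (hq1 i)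
        · exact mul_le_of_le_one_right (sum_nonneg fun j _ => hwx j n) (hq2 n)
    _ = 2 * ∑ i, ∑ n, w i n * x i n := by
        rw [sum_comm (s := (univ : Finset N))]; ring

theorem prob_nonneg (E : Env I N) (t : E.State) : 0 ≤ E.prob t :=
  prod_nonneg fun i _ => E.μ_nonneg i (t i)

theorem sum_prob (E : Env I N) : ∑ t : E.State, E.prob t = 1 := by
  simp only [prob]
  rw [← Fintype.prod_sum]
  exact prod_eq_one fun i _ => E.μ_sum i

/-- Redrawing the type of one agent does not change the distribution of the state. -/
theorem sum_resample (E : Env I N) (i : I) (F : E.State → ℝ) :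
    ∑ τ, E.μ i τ * ∑ t : E.State, E.prob t * F (Function.update t i τ)
      = ∑ t : E.State, E.prob t * F t := by
  classical
  -- A state splits into the type of `i` and the types of the others. The overwritten type of `i`
  -- then sums out to total mass one.
  have hsplit : ∀ G : E.State → ℝ,
      ∑ t : E.State, G t = ∑ σ : E.Ty i, ∑ s : ((j : {j // j ≠ i}) → E.Ty j),
        G ((Equiv.piSplitAt i E.Ty).symm (σ, s)) := fun G => by
    rw [← Fintype.sum_prod_type', ← (Equiv.piSplitAt i E.Ty).symm.sum_comp]
  have hprob : ∀ (σ : E.Ty i) (s : (j : {j // j ≠ i}) → E.Ty j),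
      E.prob ((Equiv.piSplitAt i E.Ty).symm (σ, s)) = E.μ i σ * ∏ j : {j // j ≠ i}, E.μ j (s j) := by
    intro σ s
    rw [prob, Fintype.prod_eq_mul_prod_subtype_ne _ i]
    congr 1
    · simp [Equiv.piSplitAt]
    · refine prod_congr rfl fun j _ => ?_
      simp [Equiv.piSplitAt, j.2]
  have hup : ∀ (σ τ : E.Ty i) (s : (j : {j // j ≠ i}) → E.Ty j),
      Function.update ((Equiv.piSplitAt i E.Ty).symm (σ, s)) i τ
        = (Equiv.piSplitAt i E.Ty).symm (τ, s) := by
    intro σ τ s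
    ext1 j
    by_cases hj : j = i
    · subst hj; simp [Equiv.piSplitAt]
    · simp [Equiv.piSplitAt, hj]
  rw [hsplit fun t => E.prob t * F t]
  refine sum_congr rfl fun τ _ => ?_
  rw [hsplit]
  simp only [hprob, hup]
  rw [sum_comm, mul_sum]
  refine sum_congr rfl fun s _ => ?_
  rw [← sum_mul, ← sum_mul, E.μ_sum, one_mul, mul_assoc]

theorem sum_triple (E : Env I N) (F : E.Triple → ℝ) :
    ∑ a, F a = ∑ i, ∑ τ : E.Ty i, ∑ n, F ⟨i, τ, n⟩ := by
  rw [Fintype.sum_sigma]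
  exact sum_congr rfl fun i _ => Fintype.sum_prod_type _

/-- Sums over triples against an interim allocation are expectations over states. -/
theorem sum_mul_interim (E : Env I N) (q : E.State → I → N → ℝ) (g : E.Triple → ℝ) :
    ∑ a : E.Triple, g a * E.μ a.1 a.2.1 * E.interim q a
      = ∑ t : E.State, E.prob t * ∑ i, ∑ n, g ⟨i, t i, n⟩ * q t i n := by
  rw [sum_triple]
  simp_rw [mul_sum]
  rw [sum_comm (s := (univ : Finset E.State))]
  refine sum_congr rfl fun i _ => ?_
  have h := E.sum_resample i (fun t => ∑ n, g ⟨i, t i, n⟩ * q t i n)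
  simp only [Function.update_self, mul_sum] at h
  rw [← h]
  refine sum_congr rfl fun τ _ => ?_
  rw [sum_comm]
  refine sum_congr rfl fun n _ => ?_
  simp only [interim, mul_sum]
  exact sum_congr rfl fun t _ => by ring

/-- The greedy allocation gets at least half of the expected value of any realizable interim
allocation. -/
theorem sum_le_two_mul_sum_interim_greedy (E : Env I N) (R : E.Order) (A : Set E.Triple)
    (g : E.Triple → ℝ) (hg0 : ∀ a ∈ A, 0 ≤ g a) (hgA : ∀ a, a ∉ A → g a ≤ 0)
    (hg : ∀ k l, k ≤ l → g (R l) ≤ g (R k)) {Q : E.Triple → ℝ} (hQ : Q ∈ E.realizable) :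
    ∑ a : E.Triple, g a * E.μ a.1 a.2.1 * Q a
      ≤ 2 * ∑ a : E.Triple, g a * E.μ a.1 a.2.1 * E.interim (E.greedy R A) a := by
  obtain ⟨q, hq, rfl⟩ := hQ
  rw [sum_mul_interim, sum_mul_interim, mul_sum]
  refine sum_le_sum fun t _ => ?_
  have := mul_le_mul_of_nonneg_left (E.sum_le_two_mul_sum_greedy R A g hg0 hgA hg hq t)
    (E.prob_nonneg t)
  linarith

theorem interim_mem_realizable (E : Env I N) (R : E.Order) (A : Set E.Triple) :
    E.interim (E.greedy R A) ∈ E.realizable :=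
  ⟨_, E.greedy_isAllocation R A, rfl⟩

theorem weight_antitone {E : Env I N} {base : I ≃ Fin (Fintype.card I)} {R : E.Order}
    (hR : E.IsDesignOrder base R) (k l : Fin (Fintype.card E.Triple)) (h : k ≤ l) :
    E.weight (R l) ≤ E.weight (R k) := by
  rcases h.eq_or_lt with rfl | h
  · rfl
  · exact hR.1 _ _ h

theorem half_rev_le {E : Env I N} {base : I ≃ Fin (Fintype.card I)} {R : E.Order}
    (hR : E.IsDesignOrder base R) {A : Set E.Triple} (hA0 : ∀ a ∈ A, 0 ≤ E.weight a)
    (hA : ∀ a, a ∉ A → E.weight a ≤ 0) {Q : E.Triple → ℝ} (hQ : Q ∈ E.realizable) :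
    1 / 2 * E.rev Q ≤ E.rev (E.interim (E.greedy R A)) := by
  have := E.sum_le_two_mul_sum_interim_greedy R A E.weight hA0 hA (weight_antitone hR) hQ
  rw [rev, rev]
  linarith

theorem null_mem_realizable (E : Env I N) : (0 : E.Triple → ℝ) ∈ E.realizable :=
  ⟨fun _ _ _ => 0, fun _ => by simp, by ext a; simp [interim]⟩

/-- A partial sum along `R` is the expected value for the indicator of an initial segment, which is
nonnegative and decreasing along `R`, so the factor-two bound applies. -/
theorem FOSDDominated_half (E : Env I N) (R : E.Order) {Q : E.Triple → ℝ}
    (hQ : Q ∈ E.realizable) :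
    E.FOSDDominated R ((1 / 2 : ℝ) • Q) (E.interim (E.greedy R Set.univ)) := by
  intro k
  have conv : ∀ Q' : E.Triple → ℝ, ∑ l ∈ Iic k, Q' (R l) * E.μ (R l).1 (R l).2.1
      = ∑ a : E.Triple, (if R.symm a ≤ k then (1 : ℝ) else 0) * E.μ a.1 a.2.1 * Q' a := by
    intro Q'
    rw [← R.sum_comp]
    simp only [Equiv.symm_apply_apply, ite_mul, one_mul, zero_mul]
    rw [← sum_filter]
    refine sum_congr (by ext; simp) fun l _ => mul_comm _ _
  have := E.sum_le_two_mul_sum_interim_greedy R Set.univ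
    (fun a => if R.symm a ≤ k then (1 : ℝ) else 0)
    (fun a _ => by split_ifs <;> norm_num) (fun a h => absurd (Set.mem_univ a) h)
    (fun l m hlm => by
      simp only [Equiv.symm_apply_apply]
      split_ifs with h1 h2
      · rfl
      · exact absurd (hlm.trans h1) h2
      · exact zero_le_one
      · rfl) hQ
  rw [conv, conv]
  have hhalf : ∑ a : E.Triple, (if R.symm a ≤ k then (1 : ℝ) else 0) * E.μ a.1 a.2.1
        * ((1 / 2 : ℝ) • Q) a
      = 1 / 2 * ∑ a : E.Triple, (if R.symm a ≤ k then (1 : ℝ) else 0) * E.μ a.1 a.2.1 * Q a := by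
    rw [mul_sum]
    exact sum_congr rfl fun a _ => by simp only [Pi.smul_apply, smul_eq_mul]; ring
  rw [hhalf]
  linarith

/-- `Q / 2` is the midpoint of `Q` and the null allocation. Concavity gives `W Q / 2 ≤ W (Q / 2)`,
and dominance does the rest. -/
theorem half_objective_le {E : Env I N} {R : E.Order} {W : (E.Triple → ℝ) → ℝ}
    (hW : E.IsObjective R W) {Q : E.Triple → ℝ} (hQ : Q ∈ E.realizable) :
    1 / 2 * W Q ≤ W (E.interim (E.greedy R Set.univ)) := by
  obtain ⟨hconc, h0, hmono⟩ := hW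
  have hhalf : (1 / 2 : ℝ) • Q ∈ E.realizable := by
    have := hconc.1 hQ E.null_mem_realizable (by norm_num : (0 : ℝ) ≤ 1 / 2)
      (by norm_num : (0 : ℝ) ≤ 1 / 2) (by norm_num)
    simpa using this
  have h1 := hconc.2 hQ E.null_mem_realizable (by norm_num : (0 : ℝ) ≤ 1 / 2)
      (by norm_num : (0 : ℝ) ≤ 1 / 2) (by norm_num)
  rw [h0, smul_zero, smul_zero, add_zero, add_zero, smul_eq_mul] at h1
  exact h1.trans (hmono _ hhalf _ (E.interim_mem_realizable R _) (E.FOSDDominated_half R hQ))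

/-! ### Monotonicity in an agent's own report -/

/-- Triples of other agents that precede a triple of agent `a.1` also precede every triple of the
same agent with a weakly smaller weight. -/
theorem IsDesignOrder.lt_of_weight_le {E : Env I N} {base : I ≃ Fin (Fintype.card I)}
    {R : E.Order} (hR : E.IsDesignOrder base R) {a a' b : E.Triple} (haa : a.1 = a'.1)
    (hb : b.1 ≠ a.1) (hw : E.weight a ≤ E.weight a') (hlt : R.symm b < R.symm a') :
    R.symm b < R.symm a := by
  -- Otherwise all three weights coincide, and the order of `b` relative to `a` and to `a'` is
  -- decided by the same comparison of agents.
  by_contra! hle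
  have h1 : E.weight a' ≤ E.weight b := by
    have := weight_antitone hR _ _ hlt.le
    simpa only [Equiv.apply_symm_apply] using this
  have h2 : E.weight b ≤ E.weight a := by
    have := weight_antitone hR _ _ hle
    simpa only [Equiv.apply_symm_apply] using this
  have hne : base b.1 ≠ base a.1 := fun h => hb (base.injective h)
  rcases lt_or_gt_of_ne hne with h | h
  · exact absurd (hR.2 b a (by linarith) h) (not_lt.2 hle)
  · rw [haa] at h
    exact absurd (hR.2 a' b (by linarith) h) (not_lt.2 hlt.le)

/-- Sets of admissible triples for which the greedy algorithm respects the preferences of every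
agent: with a triple they contain all triples of weakly larger weight, their virtual values are
nonnegative, and the order ranks the triples of one type by the preference of the type. -/
structure Regular (E : Env I N) (R : E.Order) (A : Set E.Triple) : Prop where
  upward : ∀ a ∈ A, ∀ b, E.weight a ≤ E.weight b → b ∈ A
  nonneg : ∀ a ∈ A, 0 ≤ E.virtualValue a.1 a.2.1.1 a.2.1.2
  prefer : ∀ i (τ : E.Ty i) n m, (⟨i, τ, n⟩ : E.Triple) ∈ A →
    R.symm ⟨i, τ, m⟩ ≤ R.symm ⟨i, τ, n⟩ → E.hval τ.2 n ≤ E.hval τ.2 m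

theorem update_pair_ne {E : Env I N} (t : E.State) (i : I) (τ : E.Ty i) {p : I × N}
    (h : p.1 ≠ i) :
    (⟨p.1, Function.update t i τ p.1, p.2⟩ : E.Triple) = ⟨p.1, t p.1, p.2⟩ := by
  rw [Function.update_of_ne h]

/-- If the weight of the triple that gives `n` to `i` rises because `i` changes the reported type,
then `i` gets `n` or an item that comes earlier for the new type. -/
theorem exists_matched_update {E : Env I N} {base : I ≃ Fin (Fintype.card I)} {R : E.Order}
    (hR : E.IsDesignOrder base R) {A : Set E.Triple} (hA : E.Regular R A) (t : E.State) (i : I)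
    (τ : E.Ty i) (n : N) (hM : (i, n) ∈ E.matched R A t)
    (hw : E.weight ⟨i, t i, n⟩ ≤ E.weight ⟨i, τ, n⟩) :
    ∃ m, (i, m) ∈ E.matched R A (Function.update t i τ) ∧
      R.symm ⟨i, τ, m⟩ ≤ R.symm ⟨i, τ, n⟩ := by
  by_contra! hno
  set t' := Function.update t i τ with ht'
  have hpos : ∀ p : I × N, p.1 ≠ i → E.pos R t' p = E.pos R t p := fun p hp => by
    rw [pos, pos, update_pair_ne t i τ hp]
  have hposi : ∀ m, E.pos R t' (i, m) = R.symm ⟨i, τ, m⟩ := fun m => by simp [pos, ht']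
  have hbefore : ∀ p : I × N, p.1 ≠ i → E.pos R t p < R.symm ⟨i, τ, n⟩ →
      E.pos R t p < E.pos R t (i, n) := fun p hp hlt =>
    hR.lt_of_weight_le (a := ⟨i, t i, n⟩) (a' := ⟨i, τ, n⟩) rfl hp hw hlt
  -- Before the new triple of `n` is reached, the other agents are matched alike in `t` and `t'`.
  -- Agent `i` cannot interfere: in `t'` by `hno`, in `t` because its only pair is `(i, n)`, which
  -- comes later by `hbefore`.
  have key : ∀ k : ℕ, ∀ p : I × N, p.1 ≠ i → (E.pos R t p : ℕ) = k →
      E.pos R t p < R.symm ⟨i, τ, n⟩ → (p ∈ E.matched R A t ↔ p ∈ E.matched R A t') := by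
    intro k
    induction k using Nat.strong_induction_on with
    | _ k ih =>
      intro p hp hk hlt
      rw [mem_matched, mem_matched, update_pair_ne t i τ hp, hpos p hp]
      refine and_congr_right fun _ => ⟨fun h p' hp' hlt' => ?_, fun h p' hp' hlt' => ?_⟩
      · by_cases hi : p'.1 = i
        · obtain ⟨j, m⟩ := p'
          dsimp only at hi
          subst hi
          rw [hposi] at hlt'
          exact absurd (hlt'.trans hlt) (not_lt.2 (hno m hp').le)
        · rw [hpos p' hi] at hlt'
          have hlt'' := hlt'
          rw [Fin.lt_def] at hlt''
          exact h p' ((ih _ (hk ▸ hlt'') p' hi rfl (hlt'.trans hlt)).2 hp') hlt'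
      · by_cases hi : p'.1 = i
        · have := E.matched_unique R A t hp' hM (Or.inl hi)
          subst this
          exact absurd (hbefore p hp hlt) (not_lt.2 hlt'.le)
        · have hlt'' := hlt'
          rw [Fin.lt_def] at hlt''
          exact h p' ((ih _ (hk ▸ hlt'') p' hi rfl (hlt'.trans hlt)).1 hp')
            (by rwa [hpos p' hi])
  have hnot : (i, n) ∉ E.matched R A t' := fun h => lt_irrefl _ (hno n h)
  apply hnot
  rw [mem_matched]
  refine ⟨?_, fun p hp hlt => ?_⟩
  · simp only [ht', Function.update_self]
    exact hA.upward _ ((E.mem_matched R A t _).1 hM).1 _ hw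
  · rw [hposi] at hlt
    have hpi : p.1 ≠ i := by
      rintro rfl
      obtain ⟨j, m⟩ := p
      rw [hposi] at hlt
      exact absurd hlt (not_lt.2 (hno m hp).le)
    refine ⟨hpi, fun hpn => hpi ?_⟩
    rw [hpos p hpi] at hlt
    rw [E.matched_unique R A t ((key _ p hpi rfl hlt).2 hp) hM (Or.inr hpn)]

theorem hval_injective (E : Env I N) (h : N ≃ Fin (Fintype.card N)) :
    Function.Injective (E.hval h) :=
  E.level_strictMono.injective.comp h.injective

/-! ### Symmetry under relabelling of items -/

/-- Relabelling the items by `π` in a type. -/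
def relabel (E : Env I N) (π : Equiv.Perm N) (i : I) : E.Ty i ≃ E.Ty i where
  toFun τ := (τ.1, π.trans τ.2)
  invFun τ := (τ.1, π.symm.trans τ.2)
  left_inv τ := by ext <;> simp
  right_inv τ := by ext <;> simp

/-- Relabelling the items by `π` in the types of all agents. -/
def relabelState (E : Env I N) (π : Equiv.Perm N) : E.State ≃ E.State :=
  Equiv.piCongrRight (E.relabel π)

/-- The probability of a type does not depend on its horizontal part. -/
def Exchangeable (E : Env I N) : Prop :=
  ∀ i v h h', E.μ i (v, h) = E.μ i (v, h')

theorem Exchangeable.condMass_eq {E : Env I N} (hE : E.Exchangeable) (i : I) (v : ↥(E.V i))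
    (h h' : N ≃ Fin (Fintype.card N)) : E.condMass i v h = E.condMass i v h' := by
  simp only [condMass, hMarg, hE i _ h h']

theorem Exchangeable.virtualValue_eq {E : Env I N} (hE : E.Exchangeable) (i : I) (v : ↥(E.V i))
    (h h' : N ≃ Fin (Fintype.card N)) : E.virtualValue i v h = E.virtualValue i v h' := by
  simp only [virtualValue, condCDF, hE.condMass_eq i _ h h']

theorem Exchangeable.weight_relabel {E : Env I N} (hE : E.Exchangeable) (π : Equiv.Perm N) (i : I)
    (τ : E.Ty i) (n : N) : E.weight ⟨i, E.relabel π i τ, n⟩ = E.weight ⟨i, τ, π n⟩ := by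
  simp only [weight, relabel, hval, Equiv.coe_fn_mk, Equiv.trans_apply,
    hE.virtualValue_eq i τ.1 (π.trans τ.2) τ.2]

theorem Exchangeable.prob_relabelState {E : Env I N} (hE : E.Exchangeable) (π : Equiv.Perm N)
    (t : E.State) : E.prob (E.relabelState π t) = E.prob t :=
  prod_congr rfl fun _ _ => hE _ _ _ _

theorem relabelState_update (E : Env I N) (π : Equiv.Perm N) (t : E.State) (i : I) (τ : E.Ty i) :
    E.relabelState π (Function.update t i τ)
      = Function.update (E.relabelState π t) i (E.relabel π i τ) := by
  ext1 j
  by_cases hj : j = i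
  · subst hj; simp [relabelState]
  · simp [relabelState, hj]

/-- Levels are distinct, so `prefer` sharpens to an equivalence. It fixes the order within a type
even when a zero virtual value makes all weights tie. -/
theorem Regular.lt_iff {E : Env I N} {R : E.Order} {A : Set E.Triple} (hA : E.Regular R A) (i : I)
    (τ : E.Ty i) (n m : N) (hn : (⟨i, τ, n⟩ : E.Triple) ∈ A) (hm : (⟨i, τ, m⟩ : E.Triple) ∈ A) :
    R.symm ⟨i, τ, m⟩ < R.symm ⟨i, τ, n⟩ ↔ E.hval τ.2 n < E.hval τ.2 m := by
  constructor
  · intro h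
    refine lt_of_le_of_ne (hA.prefer i τ n m hn h.le) fun he => ?_
    rw [E.hval_injective _ he] at h
    exact lt_irrefl _ h
  · intro h
    by_contra! hle
    exact absurd (hA.prefer i τ m n hm hle) (not_le.2 h)

/-- The greedy matching commutes with relabelling the items. -/
theorem matched_relabelState {E : Env I N} {base : I ≃ Fin (Fintype.card I)} {R : E.Order}
    (hR : E.IsDesignOrder base R) (hE : E.Exchangeable) {A : Set E.Triple} (hA : E.Regular R A)
    (π : Equiv.Perm N) (t : E.State) (p : I × N) :
    p ∈ E.matched R A (E.relabelState π t) ↔ (p.1, π p.2) ∈ E.matched R A t := by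
  have hw : ∀ p : I × N, E.weight ⟨p.1, E.relabelState π t p.1, p.2⟩
      = E.weight ⟨p.1, t p.1, π p.2⟩ := fun p => hE.weight_relabel π p.1 (t p.1) p.2
  have hmem : ∀ p : I × N, (⟨p.1, E.relabelState π t p.1, p.2⟩ : E.Triple) ∈ A
      ↔ (⟨p.1, t p.1, π p.2⟩ : E.Triple) ∈ A := fun p =>
    ⟨fun h => hA.upward _ h _ (hw p).le, fun h => hA.upward _ h _ (hw p).ge⟩
  have hlt : ∀ p p' : I × N, (⟨p.1, t p.1, π p.2⟩ : E.Triple) ∈ A →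
      (⟨p'.1, t p'.1, π p'.2⟩ : E.Triple) ∈ A →
      (E.pos R (E.relabelState π t) p' < E.pos R (E.relabelState π t) p
        ↔ E.pos R t (p'.1, π p'.2) < E.pos R t (p.1, π p.2)) := by
    rintro ⟨i, n⟩ ⟨j, m⟩ h h'
    by_cases hij : j = i
    · subst hij
      rw [pos, pos, hA.lt_iff j _ n m ((hmem (j, n)).2 h) ((hmem (j, m)).2 h'), pos,
        pos, hA.lt_iff j _ _ _ h h']
      rfl
    -- For different agents, the order depends only on weights and agents; one triple is replaced at
    -- a time.
    · have flip : ∀ {a a' b b' : E.Triple}, a.1 = a'.1 → b.1 = b'.1 → b.1 ≠ a.1 →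
          E.weight a = E.weight a' → E.weight b = E.weight b' → R.symm b' < R.symm a' →
          R.symm b < R.symm a := by
        intro a a' b b' haa hbb hba hwa hwb hl
        have h1 : R.symm b' < R.symm a :=
          hR.lt_of_weight_le haa (fun h => hba (hbb.trans h)) hwa.le hl
        by_contra! hle
        have h2 : R.symm a < R.symm b := lt_of_le_of_ne hle fun he => by
          exact hba (congrArg Sigma.fst (R.symm.injective he)).symm
        have h3 := hR.lt_of_weight_le (a := b') hbb.symm (fun h => hba (hbb.trans h.symm)) hwb.ge h2
        exact lt_asymm h1 h3
      exact ⟨flip rfl rfl hij (hw (i, n)).symm (hw (j, m)).symm,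
        flip rfl rfl hij (hw (i, n)) (hw (j, m))⟩
  have key : ∀ k : ℕ, ∀ p : I × N, (E.pos R (E.relabelState π t) p : ℕ) = k →
      (p ∈ E.matched R A (E.relabelState π t) ↔ (p.1, π p.2) ∈ E.matched R A t) := by
    intro k
    induction k using Nat.strong_induction_on with
    | _ k ih =>
      intro p hk
      rw [mem_matched, mem_matched, hmem p]
      refine and_congr_right fun hpA => ⟨fun h p' hp' hl => ?_, fun h p' hp' hl => ?_⟩
      · obtain ⟨j, m⟩ := p'
        obtain ⟨m, rfl⟩ := π.surjective m
        have hl' := (hlt p (j, m) hpA ((E.mem_matched R A t _).1 hp').1).2 hl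
        have hl'' := hl'
        rw [Fin.lt_def, hk] at hl''
        have := h (j, m) ((ih _ hl'' (j, m) rfl).2 hp') hl'
        exact ⟨this.1, fun he => this.2 (π.injective he)⟩
      · have hp'A := (hmem p').1 ((E.mem_matched R A _ _).1 hp').1
        have hl' := (hlt p p' hpA hp'A).1 hl
        rw [Fin.lt_def, hk] at hl
        have := h (p'.1, π p'.2) ((ih _ hl p' rfl).1 hp') hl'
        exact ⟨this.1, fun he => this.2 (congrArg π he)⟩
  exact key _ p rfl

/-- The interim greedy allocation of a type commutes with relabelling the items. -/
theorem interim_greedy_relabel {E : Env I N} {base : I ≃ Fin (Fintype.card I)} {R : E.Order}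
    (hR : E.IsDesignOrder base R) (hE : E.Exchangeable) {A : Set E.Triple} (hA : E.Regular R A)
    (π : Equiv.Perm N) (i : I) (τ : E.Ty i) (n : N) :
    E.interim (E.greedy R A) ⟨i, E.relabel π i τ, n⟩ = E.interim (E.greedy R A) ⟨i, τ, π n⟩ := by
  simp only [interim]
  rw [← (E.relabelState π).sum_comp]
  refine sum_congr rfl fun t _ => ?_
  rw [hE.prob_relabelState, ← relabelState_update, greedy_eq, greedy_eq]
  simp only [matched_relabelState hR hE hA π _ (i, n)]

/-- A type that gets `n` and then exchanges the ranks of `n` and a better item `m`, gets `m`. -/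
theorem matched_update_swap {E : Env I N} {base : I ≃ Fin (Fintype.card I)} {R : E.Order}
    (hR : E.IsDesignOrder base R) (hE : E.Exchangeable) {A : Set E.Triple} (hA : E.Regular R A)
    (t : E.State) (i : I) (n m : N) (hnm : E.hval (t i).2 n ≤ E.hval (t i).2 m)
    (hM : (i, n) ∈ E.matched R A t) :
    (i, n) ∈ E.matched R A (Function.update t i (E.relabel (Equiv.swap n m) i (t i))) := by
  set τ := E.relabel (Equiv.swap n m) i (t i) with hτ
  have hnA := ((E.mem_matched R A t _).1 hM).1
  have hval_eq : ∀ k, E.hval τ.2 k = E.hval (t i).2 (Equiv.swap n m k) := fun k => rfl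
  have hw : ∀ k, E.weight ⟨i, τ, k⟩ = E.weight ⟨i, t i, Equiv.swap n m k⟩ :=
    hE.weight_relabel _ i (t i)
  have hwle : E.weight ⟨i, t i, n⟩ ≤ E.weight ⟨i, τ, n⟩ := by
    rw [hw, Equiv.swap_apply_left]
    exact mul_le_mul_of_nonneg_left hnm (hA.nonneg _ hnA)
  obtain ⟨k, hk, hkle⟩ := exists_matched_update hR hA t i τ n hM hwle
  by_cases hkn : k = n
  · rwa [hkn] at hk
  -- Suppose the new type gets `k ≠ n`, which it strictly prefers to `n`. Then `k ≠ m`, so the swap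
  -- leaves the weight of `k` unchanged, and reverting the report yields an item at least as good as
  -- `k`. That item is `n`, so for the old type `k ≤ n ≤ m < k` in value.
  exfalso
  have h1 := hA.prefer i τ n k (hA.upward _ hnA _ hwle) hkle
  have h2 : E.hval τ.2 n < E.hval τ.2 k :=
    lt_of_le_of_ne h1 fun he => hkn (E.hval_injective _ he).symm
  have hkm : k ≠ m := by
    rintro rfl
    rw [hval_eq, hval_eq, Equiv.swap_apply_left, Equiv.swap_apply_right] at h2
    exact absurd hnm (not_le.2 h2)
  have hsw : Equiv.swap n m k = k := Equiv.swap_apply_of_ne_of_ne hkn hkm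
  have hback : Function.update (Function.update t i τ) i (t i) = t := by simp
  obtain ⟨l, hl, hlle⟩ := exists_matched_update hR hA (Function.update t i τ) i (t i) k hk
    (by rw [Function.update_self, hw, hsw])
  rw [hback] at hl
  have hln : l = n := (Prod.mk.inj (E.matched_unique R A t hl hM (Or.inl rfl))).2
  subst hln
  have hkA : (⟨i, t i, k⟩ : E.Triple) ∈ A := by
    have := ((E.mem_matched R A _ _).1 hk).1
    simp only [Function.update_self] at this
    exact hA.upward _ this _ (by rw [hw, hsw])
  have h3 := hA.prefer i (t i) k l hkA hlle
  rw [hval_eq, hval_eq, hsw, Equiv.swap_apply_left] at h2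
  linarith

/-- A type gets a better item with a higher probability. -/
theorem interim_greedy_le_of_hval_le {E : Env I N} {base : I ≃ Fin (Fintype.card I)} {R : E.Order}
    (hR : E.IsDesignOrder base R) (hE : E.Exchangeable) {A : Set E.Triple} (hA : E.Regular R A)
    (i : I) (τ : E.Ty i) (n m : N) (hnm : E.hval τ.2 n ≤ E.hval τ.2 m) :
    E.interim (E.greedy R A) ⟨i, τ, n⟩ ≤ E.interim (E.greedy R A) ⟨i, τ, m⟩ := by
  have hm : m = Equiv.swap n m n := (Equiv.swap_apply_left n m).symm
  -- Symmetry turns "item `m` for `τ`" into "item `n` for the swapped type", which can be compared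
  -- state by state.
  conv_rhs => rw [hm, ← interim_greedy_relabel hR hE hA]
  refine sum_le_sum fun t _ => mul_le_mul_of_nonneg_left ?_ (E.prob_nonneg t)
  rw [greedy_eq, greedy_eq]
  by_cases h : (i, n) ∈ E.matched R A (Function.update t i τ)
  · have := matched_update_swap hR hE hA (Function.update t i τ) i n m (by simpa using hnm) h
    simp only [Function.update_self, Function.update_idem] at this
    dsimp only
    rw [if_pos h, if_pos this]
  · rw [if_neg h]
    split_ifs <;> norm_num

/-! ### Expected quality, incentives and payments -/

/-- Value units that a truthful type gets in the interim greedy allocation. -/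
def quality (E : Env I N) (R : E.Order) (A : Set E.Triple) (i : I) (τ : E.Ty i) : ℝ :=
  ∑ n, E.interim (E.greedy R A) ⟨i, τ, n⟩ * E.hval τ.2 n

theorem quality_relabel {E : Env I N} {base : I ≃ Fin (Fintype.card I)} {R : E.Order}
    (hR : E.IsDesignOrder base R) (hE : E.Exchangeable) {A : Set E.Triple} (hA : E.Regular R A)
    (π : Equiv.Perm N) (i : I) (τ : E.Ty i) :
    E.quality R A i (E.relabel π i τ) = E.quality R A i τ := by
  rw [quality, quality, ← Equiv.sum_comp π (fun n => E.interim (E.greedy R A) ⟨i, τ, n⟩ * E.hval τ.2 n)]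
  exact sum_congr rfl fun n _ => by rw [interim_greedy_relabel hR hE hA]; rfl

/-- Any two horizontal types are relabellings of each other. This reduces screening to the vertical
type. -/
theorem quality_eq {E : Env I N} {base : I ≃ Fin (Fintype.card I)} {R : E.Order}
    (hR : E.IsDesignOrder base R) (hE : E.Exchangeable) {A : Set E.Triple} (hA : E.Regular R A)
    (i : I) (v : ↥(E.V i)) (h h' : N ≃ Fin (Fintype.card N)) :
    E.quality R A i (v, h) = E.quality R A i (v, h') := by
  have : ((v, h) : E.Ty i) = E.relabel (h.trans h'.symm) i (v, h') := by
    ext <;> simp [relabel]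
  rw [this, quality_relabel hR hE hA]

theorem interim_greedy_nonneg (E : Env I N) (R : E.Order) (A : Set E.Triple) (a : E.Triple) :
    0 ≤ E.interim (E.greedy R A) a :=
  sum_nonneg fun t _ => mul_nonneg (E.prob_nonneg t) (E.greedy_nonneg R A _ _ _)

/-- Misreporting the horizontal type is not profitable. -/
theorem misreport_le_quality {E : Env I N} {base : I ≃ Fin (Fintype.card I)} {R : E.Order}
    (hR : E.IsDesignOrder base R) (hE : E.Exchangeable) {A : Set E.Triple} (hA : E.Regular R A)
    (i : I) (v : ↥(E.V i)) (h h' : N ≃ Fin (Fintype.card N)) :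
    ∑ n, E.interim (E.greedy R A) ⟨i, (v, h'), n⟩ * E.hval h n ≤ E.quality R A i (v, h) := by
  have hmv : Monovary (fun n => E.interim (E.greedy R A) ⟨i, (v, h), n⟩) (E.hval h) :=
    fun n m hlt => interim_greedy_le_of_hval_le hR hE hA i (v, h) n m hlt.le
  -- Rearrangement inequality: the misreport `h'` permutes probabilities that are ordered like the
  -- values.
  have key := hmv.sum_comp_perm_mul_le_sum_mul (σ := h'.trans h.symm)
  have hrel : ((v, h') : E.Ty i) = E.relabel (h'.trans h.symm) i (v, h) := by
    ext <;> simp [relabel]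
  rw [hrel]
  simp only [interim_greedy_relabel hR hE hA]
  exact key

/-- A higher virtual value brings a better item. -/
theorem quality_mono {E : Env I N} {base : I ≃ Fin (Fintype.card I)} {R : E.Order}
    (hR : E.IsDesignOrder base R) {A : Set E.Triple} (hA : E.Regular R A)
    (hpos : ∀ h n, 0 ≤ E.hval h n) (i : I) (v w : ↥(E.V i)) (h : N ≃ Fin (Fintype.card N))
    (hvw : E.virtualValue i v h ≤ E.virtualValue i w h) :
    E.quality R A i (v, h) ≤ E.quality R A i (w, h) := by
  simp only [quality, interim, sum_mul]
  rw [sum_comm, sum_comm (s := (univ : Finset N))]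
  refine sum_le_sum fun t _ => ?_
  simp only [mul_assoc, ← mul_sum]
  refine mul_le_mul_of_nonneg_left ?_ (E.prob_nonneg t)
  have hnn : ∀ n, 0 ≤ E.greedy R A (Function.update t i (w, h)) i n * E.hval h n := fun n =>
    mul_nonneg (E.greedy_nonneg R A _ _ _) (hpos h n)
  by_cases hex : ∃ n, (i, n) ∈ E.matched R A (Function.update t i (v, h))
  · obtain ⟨n, hn⟩ := hex
    have hw : E.weight ⟨i, (v, h), n⟩ ≤ E.weight ⟨i, (w, h), n⟩ :=
      mul_le_mul_of_nonneg_right hvw (hpos h n)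
    obtain ⟨m, hm, hle⟩ := exists_matched_update hR hA (Function.update t i (v, h)) i (w, h) n hn
      (by simpa using hw)
    rw [Function.update_idem] at hm
    have hnA : (⟨i, (v, h), n⟩ : E.Triple) ∈ A := by
      simpa using ((E.mem_matched R A _ _).1 hn).1
    have hnm := hA.prefer i (w, h) n m (hA.upward _ hnA _ hw) hle
    calc ∑ k, E.greedy R A (Function.update t i (v, h)) i k * E.hval h k
        = E.hval h n := by
          rw [sum_eq_single n, greedy_eq, if_pos hn, one_mul]
          · intro k _ hk
            rw [greedy_eq, if_neg, zero_mul]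
            intro hk'
            exact hk (Prod.mk.inj (E.matched_unique R A _ hk' hn (Or.inl rfl))).2
          · simp
      _ ≤ E.hval h m := hnm
      _ = E.greedy R A (Function.update t i (w, h)) i m * E.hval h m := by
          rw [greedy_eq, if_pos hm, one_mul]
      _ ≤ _ := single_le_sum (fun k _ => hnn k) (mem_univ m)
  · push Not at hex
    refine le_trans (le_of_eq (sum_eq_zero fun n _ => ?_)) (sum_nonneg fun n _ => hnn n)
    rw [greedy_eq, if_neg (hex n), zero_mul]

/-- The interim payoff when the payment of an agent depends on the agent's own report only. -/
theorem interimPayoff_own (E : Env I N) (q : E.State → I → N → ℝ) (P : (i : I) → E.Ty i → ℝ)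
    (i : I) (τ τ' : E.Ty i) :
    E.interimPayoff q (fun t i => P i (t i)) i τ τ'
      = (τ.1 : ℝ) * ∑ n, E.interim q ⟨i, τ', n⟩ * E.hval τ.2 n - P i τ' := by
  simp only [interimPayoff, Function.update_self, mul_sub, sum_sub_distrib, ← sum_mul, E.sum_prob,
    one_mul, interim]
  congr 1
  simp only [mul_sum, sum_mul]
  rw [sum_comm]
  exact sum_congr rfl fun n _ => sum_congr rfl fun t _ => by ring

theorem expectedPayment_own (E : Env I N) (P : (i : I) → E.Ty i → ℝ) :
    E.expectedPayment (fun t i => P i (t i)) = ∑ i, ∑ τ : E.Ty i, E.μ i τ * P i τ := by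
  simp only [expectedPayment, mul_sum]
  rw [sum_comm]
  refine sum_congr rfl fun i _ => ?_
  rw [← E.sum_resample i (fun t => P i (t i))]
  simp only [Function.update_self, ← sum_mul, E.sum_prob, one_mul]

theorem rev_greedy (E : Env I N) (R : E.Order) (A : Set E.Triple) :
    E.rev (E.interim (E.greedy R A)) = ∑ i, ∑ τ : E.Ty i,
      E.μ i τ * (E.virtualValue i τ.1 τ.2 * E.quality R A i τ) := by
  rw [rev, sum_triple]
  refine sum_congr rfl fun i _ => sum_congr rfl fun τ _ => ?_
  rw [quality, mul_sum, mul_sum]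
  refine sum_congr rfl fun n _ => ?_
  simp only [weight]
  ring

/-- Exchange of the order of summation that turns information rents into inverse hazard rates. -/
theorem sum_mul_rent {V : Finset ℝ} (f y : ↥V → ℝ) :
    ∑ v, f v * ∑ w with w < v, y w = ∑ v, (∑ w, f w - ∑ w with w ≤ v, f w) * y v := by
  have h : ∀ v, ∑ w, f w - ∑ w with w ≤ v, f w = ∑ w with v < w, f w := fun v => by
    rw [← sum_filter_add_sum_filter_not univ (fun w => w ≤ v) f]
    simp only [not_le, add_sub_cancel_left]
  simp only [h]
  simp only [mul_sum, sum_mul, sum_filter]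
  rw [sum_comm]
  refine sum_congr rfl fun v _ => sum_congr rfl fun w _ => ?_
  split_ifs <;> simp

/-- The payment `v * x v - S v` leaves a truthful agent the rent `S v`. A double deviation is
bounded in two steps: first correct the horizontal report, then the vertical one. -/
theorem implementable_greedy {E : Env I N} {base : I ≃ Fin (Fintype.card I)} {R : E.Order}
    (hR : E.IsDesignOrder base R) (hE : E.Exchangeable) {A : Set E.Triple} (hA : E.Regular R A)
    (hpos : ∀ h n, 0 ≤ E.hval h n)
    (hmass : ∀ i v h, E.condMass i v h = E.vMarg i v) (hsupp : ∀ i v, 0 < E.vMarg i v)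
    (hmono : ∀ i h, Monotone (fun v => E.virtualValue i v h)) :
    E.ImplementableBIC (E.greedy R A) := by
  set h₀ : N ≃ Fin (Fintype.card N) := Fintype.equivFin N
  set x : (i : I) → ℝ → ℝ := fun i r =>
    if hr : r ∈ E.V i then E.quality R A i (⟨r, hr⟩, h₀) else 0 with hx
  have hxq : ∀ i (τ : E.Ty i), E.quality R A i τ = x i τ.1 := by
    intro i τ
    rw [hx]
    dsimp only
    rw [dif_pos τ.1.2]
    exact quality_eq hR hE hA i τ.1 τ.2 h₀
  have hx0 : ∀ i, ∀ v ∈ E.V i, 0 ≤ x i v := by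
    intro i v hv
    rw [← hxq i (⟨v, hv⟩, h₀)]
    exact sum_nonneg fun n _ => mul_nonneg (E.interim_greedy_nonneg R A _) (hpos _ _)
  have hxmono : ∀ i, MonotoneOn (x i) (E.V i) := by
    intro i v hv w hw hvw
    rw [← hxq i (⟨v, hv⟩, h₀), ← hxq i (⟨w, hw⟩, h₀)]
    exact quality_mono hR hA hpos i _ _ h₀ (hmono i h₀ hvw)
  choose S hS0 hS hSgrid using fun i => exists_rent_grid (E.V i) (x i) (hxmono i) (hx0 i)
  obtain ⟨P, hP⟩ : ∃ P : (i : I) → E.Ty i → ℝ, ∀ i τ, P i τ = (τ.1 : ℝ) * x i τ.1 - S i τ.1 :=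
    ⟨_, fun _ _ => rfl⟩
  refine ⟨fun t i => P i (t i), ?_, ?_, ?_⟩
  · intro i τ τ'
    rw [interimPayoff_own, interimPayoff_own, hP, hP]
    -- Scaling the horizontal comparison by the true vertical type requires that type to be
    -- nonnegative.
    have h1 := mul_le_mul_of_nonneg_left
      (misreport_le_quality hR hE hA i τ'.1 τ.2 τ'.2) (E.V_nonneg i _ τ.1.2)
    rw [hxq] at h1
    have h2 := hS i τ.1 τ.1.2 τ'.1 τ'.1.2
    have h3 := hxq i τ
    rw [quality] at h3
    rw [h3]
    dsimp only at h1 ⊢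
    linarith
  · intro i τ
    rw [interimPayoff_own, hP]
    have h3 := hxq i τ
    rw [quality] at h3
    rw [h3]
    linarith [hS0 i τ.1 τ.1.2]
  · intro hgrid
    rw [expectedPayment_own, rev_greedy]
    refine sum_congr rfl fun i _ => ?_
    have hred : ∀ G : ↥(E.V i) → ℝ, ∑ τ : E.Ty i, E.μ i τ * G τ.1 = ∑ v, E.vMarg i v * G v := by
      intro G
      rw [Fintype.sum_prod_type]
      exact sum_congr rfl fun v _ => by rw [vMarg, sum_mul]
    have htotal : ∑ v, E.vMarg i v = 1 := by
      rw [← E.μ_sum i, Fintype.sum_prod_type]; rfl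
    have hSv : ∀ v : ↥(E.V i), S i v = ∑ w with w < v, x i w := by
      intro v
      rw [hSgrid i (hgrid i) v v.2, sum_filter, ← sum_coe_sort (E.V i), sum_filter]
      rfl
    -- Multiplied by its mass, the virtual value becomes `f v - (1 - F)`; full support allows
    -- cancelling the mass.
    have hfv : ∀ v : ↥(E.V i), E.vMarg i v * (E.virtualValue i v h₀ * x i v)
        = E.vMarg i v * (v * x i v)
          - (∑ w, E.vMarg i w - ∑ w with w ≤ v, E.vMarg i w) * x i v := by
      intro v
      have := (hsupp i v).ne'
      simp only [virtualValue, condCDF, hmass, htotal]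
      field_simp
    have hν : ∀ τ : E.Ty i, E.virtualValue i τ.1 τ.2 * E.quality R A i τ
        = E.virtualValue i τ.1 h₀ * x i τ.1 := fun τ => by
      rw [hxq, hE.virtualValue_eq i τ.1 τ.2 h₀]
    simp only [hν, hP]
    rw [hred (fun v => (v : ℝ) * x i v - S i v), hred (fun v => E.virtualValue i v h₀ * x i v)]
    simp only [hfv, hSv, mul_sub, sum_sub_distrib]
    rw [sum_mul_rent]

/-! ### Consequences of uniformity for the two greedy allocations -/

theorem exchangeable_of_uniform {E : Env I N} (hindep : E.VHIndependent)
    (hunif : E.UniformlyDistributed) : E.Exchangeable := fun i v h h' => by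
  rw [hindep, hindep, hunif, hunif]

theorem condMass_eq_vMarg {E : Env I N} (hindep : E.VHIndependent)
    (hunif : E.UniformlyDistributed) (i : I) (v : ↥(E.V i)) (h : N ≃ Fin (Fintype.card N)) :
    E.condMass i v h = E.vMarg i v := by
  have : E.hMarg i h ≠ 0 := by
    rw [hunif]; positivity
  rw [condMass, hindep, mul_div_cancel_right₀ _ this]

theorem hval_pos {E : Env I N} (hlevels : E.UniformLevels) (h : N ≃ Fin (Fintype.card N)) (n : N) :
    0 < E.hval h n := by
  rw [hval, hlevels]; positivity

theorem hval_le_of_symm_le {E : Env I N} {base : I ≃ Fin (Fintype.card I)} {R : E.Order}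
    (hR : E.IsDesignOrder base R) {i : I} {τ : E.Ty i} {n m : N}
    (hν : 0 < E.virtualValue i τ.1 τ.2) (hle : R.symm ⟨i, τ, m⟩ ≤ R.symm ⟨i, τ, n⟩) :
    E.hval τ.2 n ≤ E.hval τ.2 m := by
  have := weight_antitone hR _ _ hle
  simp only [Equiv.apply_symm_apply] at this
  exact le_of_mul_le_mul_left this hν

/-- Levels are positive, so a positive weight forces a positive virtual value, and then weights rank
items by preference. -/
theorem regular_truncated {E : Env I N} {base : I ≃ Fin (Fintype.card I)} {R : E.Order}
    (hR : E.IsDesignOrder base R) (hlevels : E.UniformLevels) :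
    E.Regular R {a | 0 < E.weight a} := by
  have hν : ∀ a : E.Triple, 0 < E.weight a → 0 < E.virtualValue a.1 a.2.1.1 a.2.1.2 :=
    fun a ha => pos_of_mul_pos_left ha (hval_pos hlevels _ _).le
  exact ⟨fun a ha b hab => lt_of_lt_of_le ha hab, fun a ha => (hν a ha).le,
    fun i τ n m hn hle => hval_le_of_symm_le hR (hν _ hn) hle⟩

/-- A type with zero virtual value has weight zero for every item, so its ranking comes from the
tie-breaking assumption alone. -/
theorem regular_univ {E : Env I N} {base : I ≃ Fin (Fintype.card I)} {R : E.Order}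
    (hR : E.IsDesignOrder base R) (hν : ∀ i v h, 0 ≤ E.virtualValue i v h)
    (hties : E.BreaksItemTiesByPreference R) : E.Regular R Set.univ := by
  refine ⟨fun _ _ _ _ => trivial, fun a _ => hν _ _ _, fun i τ n m _ hle => ?_⟩
  rcases (hν i τ.1 τ.2).eq_or_lt with h | h
  · by_contra! hlt
    exact absurd (hties i τ n m (by simp only [weight, ← h, zero_mul]) hlt) (not_lt.2 hle)
  · exact hval_le_of_symm_le hR h hle

end Env

end Matching

end

theorem mainTheorem7 {I N : Type} [Fintype I] [DecidableEq I] [Fintype N] [DecidableEq N]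
    (E : Matching.Env I N)
    (hsupp : ∀ i v, 0 < E.vMarg i v)
    (hindep : E.VHIndependent)
    (hlevels : E.UniformLevels)
    (hunif : E.UniformlyDistributed)
    (hmono : ∀ i h, Monotone (fun v => E.virtualValue i v h))
    (base : I ≃ Fin (Fintype.card I)) (R : E.Order) (hR : E.IsDesignOrder base R) :
    -- the greedy allocation, which stops once virtual values are no longer positive
    (E.IsAllocation (E.greedy R {a | 0 < E.weight a}) ∧
      (∀ Q ∈ E.realizable, 1 / 2 * E.rev Q ≤ E.rev (E.interim (E.greedy R {a | 0 < E.weight a}))) ∧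
      E.ImplementableBIC (E.greedy R {a | 0 < E.weight a})) ∧
    -- the greedy allocation on all triples
    (E.IsAllocation (E.greedy R Set.univ) ∧
      (∀ (U : (E.Triple → ℝ) → ℝ) (β : ℝ), E.IsObjective R (fun Q => U Q + β * E.rev Q) →
        ∀ Q ∈ E.realizable, 1 / 2 * (U Q + β * E.rev Q) ≤
          U (E.interim (E.greedy R Set.univ)) + β * E.rev (E.interim (E.greedy R Set.univ))) ∧
      ((∀ i v h, 0 ≤ E.virtualValue i v h) → E.BreaksItemTiesByPreference R →
        (∀ Q ∈ E.realizable, 1 / 2 * E.rev Q ≤ E.rev (E.interim (E.greedy R Set.univ))) ∧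
        E.ImplementableBIC (E.greedy R Set.univ))) := by
  have hE := Matching.Env.exchangeable_of_uniform hindep hunif
  have hmass := Matching.Env.condMass_eq_vMarg hindep hunif
  have hpos : ∀ h n, 0 ≤ E.hval h n := fun h n => (Matching.Env.hval_pos hlevels h n).le
  refine ⟨⟨E.greedy_isAllocation R _, fun Q hQ => ?_, ?_⟩, E.greedy_isAllocation R _,
    fun U β hW Q hQ => Matching.Env.half_objective_le hW hQ, fun hν hties => ⟨fun Q hQ => ?_, ?_⟩⟩
  · exact Matching.Env.half_rev_le hR (fun a ha => le_of_lt ha) (fun a ha => not_lt.1 ha) hQ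
  · exact Matching.Env.implementable_greedy hR hE (Matching.Env.regular_truncated hR hlevels) hpos
      hmass hsupp hmono
  · exact Matching.Env.half_rev_le hR (fun a _ => mul_nonneg (hν _ _ _) (hpos _ _))
      (fun a ha => absurd (Set.mem_univ a) ha) hQ
  · exact Matching.Env.implementable_greedy hR hE (Matching.Env.regular_univ hR hν hties) hpos
      hmass hsupp hmono
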